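/- Let $x_1, x_2, \dots$ be a sequence of real numbers, and put $\Delta x_n = x_{n+1}-x_n$ and $\Delta^2 x_n = \Delta x_{n+1}-\Delta x_n$. Call a real sequence $(u_n)_{n\ge 1}$ weakly decreasing if $u_n\ge 0$ for all $n$ and there is a constant $K\ge 1$ such that $u_j\le K u_n$ whenever $j>n\ge 1$; weakly increasing if $(-u_n)$ is weakly decreasing; and weakly monotonic if it is weakly decreasing or weakly increasing. Suppose that $(\Delta^2 x_n)_{n\ge1}$ is weakly monotonic and that, as $n\to\infty$, $$\Delta^2 x_n\to 0,\qquad n^2\,|\Delta^2 x_n|\to\infty .$$ Then $(x_n)$ is uniformly distributed modulo $1$; that is, for all $0\le a<b\le 1$, $$\lim_{N\to\infty}\frac{\#\{1\le n\le N:\ \{x_n\}\in[a,b)\}}{N}=b-a,$$ where $\{t\}$ denotes the fractional part of $t$. -/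

import Mathlib

open Filter Topology

/-- The number of indices `1 ≤ n ≤ N` such that the fractional part of `x n` lies in `[a, b)`. -/
noncomputable def countFract (x : ℕ → ℝ) (a b : ℝ) (N : ℕ) : ℕ :=
  {n : ℕ | 1 ≤ n ∧ n ≤ N ∧ Int.fract (x n) ∈ Set.Ico a b}.ncard

/-- The sequence `x 1, x 2, …` is uniformly distributed modulo one. The value `x 0` plays no role. -/
def UniformlyDistributedModOne (x : ℕ → ℝ) : Prop :=
  ∀ a b : ℝ, 0 ≤ a → a < b → b ≤ 1 →
    Tendsto (fun N : ℕ => (countFract x a b N : ℝ) / (N : ℝ)) atTop (𝓝 (b - a))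

/-- The sequence `u 1, u 2, …` is nonnegative and decreasing up to a multiplicative constant. -/
def WeaklyDecreasing (u : ℕ → ℝ) : Prop :=
  (∀ n : ℕ, 1 ≤ n → 0 ≤ u n) ∧
    ∃ K : ℝ, 1 ≤ K ∧ ∀ n j : ℕ, 1 ≤ n → n < j → u j ≤ K * u n

/-- The sequence `u` is weakly increasing when `-u` is weakly decreasing. -/
def WeaklyIncreasing (u : ℕ → ℝ) : Prop :=
  WeaklyDecreasing (fun n => -u n)

/-- Weakly monotonic: weakly decreasing or weakly increasing. -/
def WeaklyMonotonic (u : ℕ → ℝ) : Prop :=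
  WeaklyDecreasing u ∨ WeaklyIncreasing u

/-- The second difference `x (n + 2) - 2 * x (n + 1) + x n`, as an iterated forward difference. -/
def secondDiff (x : ℕ → ℝ) : ℕ → ℝ :=
  fwdDiff 1 (fwdDiff 1 x)

/-! By Weyl's criterion it suffices that the averages of `expUnit (k * x n)` tend to 0 for each
integer `k ≠ 0`. Conjugation and the change of `x` to `-x` reduce this to `k > 0` and second
differences that are positive and decreasing up to a factor `K`, so the slope `d` of the phase
increases.

Cut the indices where `d` crosses `k - θ` and `k + θ` for integers `k`. While `d` stays `θ` away
from the integers, Kusmin–Landau bounds the sum by `1 / θ`. Near an integer the trivial bound is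
used: increments can grow by at most the factor `K`, so up to a bounded error this stretch is at
most about `4 * θ * K ^ 2` times the stretch that follows. There are at most `d M - d 0 + 1`
complete blocks, which is `o(M)` because the increments tend to 0.

The last block may have no stretch after it to compare with. There `θ` is replaced by `η`, at cost
`2 / η + 1 + 2 * η * K / u` with `u` the last increment. The choice `η = √u` makes this `O(1 / √u)`,
which is `o(M)` exactly because `M ^ 2 * u → ∞`. Finally `θ` is arbitrarily small. -/

/-! ### The Kusmin–Landau inequality. -/

/-- If the arguments of consecutive quotients of a unimodular sequence increase and keep distance
`θ` from the integers, then its sums are bounded by `1 / θ` (Kusmin–Landau). -/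
theorem norm_sum_Ico_le_of_monotone_phase {z : ℕ → ℂ} {t : ℕ → ℝ} {θ : ℝ} {a b : ℕ} (hθ : 0 < θ)
    (hz : ∀ n, ‖z n‖ = 1)
    (hstep : ∀ n, z (n + 1) = Complex.exp (2 * Real.pi * Complex.I * t n) * z n)
    (ht : Monotone t) (hlow : ∀ n ∈ Finset.Ico a b, θ ≤ t n)
    (hup : ∀ n ∈ Finset.Ico a b, t n ≤ 1 - θ) :
    ‖∑ i ∈ Finset.Ico a b, z i‖ ≤ 1 / θ := by
  rcases le_or_gt b a with hab | hab
  · simp [Finset.Ico_eq_empty_of_le hab, hθ.le]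
  -- Jordan's inequality, applied on either side of `π / 2`.
  have hsin : ∀ n ∈ Finset.Ico a b, 2 * θ ≤ Real.sin (Real.pi * t n) := by
    intro n hn
    have h1 := hlow n hn
    have h2 := hup n hn
    have hπ := Real.pi_pos
    rcases le_total (t n) (1 / 2) with h | h
    · have := Real.mul_le_sin (x := Real.pi * t n) (by nlinarith) (by nlinarith)
      have e : 2 / Real.pi * (Real.pi * t n) = 2 * t n := by field_simp
      linarith
    · have := Real.mul_le_sin (x := Real.pi - Real.pi * t n) (by nlinarith) (by nlinarith)
      have e : 2 / Real.pi * (Real.pi - Real.pi * t n) = 2 * (1 - t n) := by field_simp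
      rw [Real.sin_pi_sub] at this
      linarith
  set w : ℕ → ℝ := fun n => Real.cos (Real.pi * t n) / Real.sin (Real.pi * t n) with hw
  -- `c n` is `1 / (e(t n) - 1)` in cotangent form, so `z n = c n * (z (n + 1) - z n)` and Abel
  -- summation applies. Its real part is constant, so its variation is that of the monotone `w`,
  -- halved.
  set c : ℕ → ℂ := fun n => -(1 / 2) - Complex.I / 2 * (w n : ℂ) with hc
  have hkey : ∀ n ∈ Finset.Ico a b, c n * z (n + 1) - z n = c n * z n := by
    intro n hn
    have hs : Real.sin (Real.pi * t n) ≠ 0 := by have := hsin n hn; linarith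
    have hexp : Complex.exp (2 * Real.pi * Complex.I * t n) =
        ((Real.cos (Real.pi * t n) : ℂ) + Real.sin (Real.pi * t n) * Complex.I) ^ 2 := by
      rw [Complex.ofReal_cos, Complex.ofReal_sin, ← Complex.exp_mul_I, ← Complex.exp_nat_mul]
      congr 1; push_cast; ring
    have hsq : (Real.sin (Real.pi * t n) : ℂ) ^ 2 + (Real.cos (Real.pi * t n) : ℂ) ^ 2 = 1 := by
      exact_mod_cast Real.sin_sq_add_cos_sq (Real.pi * t n)
    have hs' : (Real.sin (Real.pi * t n) : ℂ) ≠ 0 := by exact_mod_cast hs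
    have h1 : c n * (Complex.exp (2 * Real.pi * Complex.I * t n) - 1) = 1 := by
      rw [hexp]
      simp only [hc, hw, Complex.ofReal_div]
      generalize (Real.sin (Real.pi * t n) : ℂ) = S at *
      generalize (Real.cos (Real.pi * t n) : ℂ) = C at *
      have e : -(1 / 2) - Complex.I / 2 * (C / S) = - (S + Complex.I * C) / (2 * S) := by
        field_simp; ring
      rw [e, div_mul_eq_mul_div, div_eq_iff (by simpa using hs')]
      have hI := Complex.I_sq
      linear_combination (-(S + Complex.I * C) + 2 * S) * hsq +
        (-(S + Complex.I * C) * S^2 - 2 * S * C ^ 2) * hI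
    rw [hstep]
    linear_combination z n * h1
  have hwanti : ∀ n ∈ Finset.Ico a b, ∀ m ∈ Finset.Ico a b, n ≤ m → w m ≤ w n := by
    intro n hn m hm hnm
    have s1 : 0 < Real.sin (Real.pi * t n) := by linarith [hsin n hn]
    have s2 : 0 < Real.sin (Real.pi * t m) := by linarith [hsin m hm]
    simp only [hw]
    rw [div_le_div_iff₀ s2 s1, ← sub_nonneg]
    have : 0 ≤ Real.sin (Real.pi * t m - Real.pi * t n) := by
      have hπ := Real.pi_pos
      have := ht hnm
      apply Real.sin_nonneg_of_nonneg_of_le_pi <;>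
        nlinarith [hlow n hn, hup m hm]
    rw [Real.sin_sub] at this
    linarith
  have hwabs : ∀ n ∈ Finset.Ico a b, |w n| ≤ 1 / (2 * θ) := by
    intro n hn
    have s1 := hsin n hn
    have s0 : 0 < Real.sin (Real.pi * t n) := by linarith
    simp only [hw]
    rw [abs_div, abs_of_pos s0]
    exact div_le_div₀ zero_le_one (Real.abs_cos_le_one _) (by positivity) s1
  have hcabs : ∀ n ∈ Finset.Ico a b, ‖c n‖ ≤ 1 / (4 * θ) := by
    intro n hn
    have s1 := hsin n hn
    have s0 : 0 < Real.sin (Real.pi * t n) := by linarith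
    have e : Complex.normSq (c n) = (1 / (2 * Real.sin (Real.pi * t n))) ^ 2 := by
      have hcn : c n = ⟨-(1 / 2), -(w n / 2)⟩ := by
        apply Complex.ext
        · simp [hc]
        · simp [hc]; ring
      rw [hcn, Complex.normSq_mk]
      simp only [hw]
      field_simp
      linarith [Real.sin_sq_add_cos_sq (Real.pi * t n)]
    rw [← Real.sqrt_sq (by positivity : (0 : ℝ) ≤ 1 / (4 * θ)), Complex.norm_def, e]
    apply Real.sqrt_le_sqrt
    have : 1 / (2 * Real.sin (Real.pi * t n)) ≤ 1 / (4 * θ) :=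
      one_div_le_one_div_of_le (by positivity) (by linarith)
    gcongr
  have hcsub : ∀ n m, ‖c n - c m‖ = |w n - w m| / 2 := by
    intro n m
    have : c n - c m = Complex.I / 2 * ((w m - w n : ℝ) : ℂ) := by
      simp only [hc]; push_cast; ring
    rw [this, norm_mul, Complex.norm_real, Real.norm_eq_abs, abs_sub_comm]
    simp
    ring
  have main : ∀ m, a ≤ m → m < b →
      ‖∑ i ∈ Finset.Ico a (m + 1), z i - c m * z (m + 1)‖ ≤ ‖c a‖ + (w a - w m) / 2 := by
    intro m hm
    induction m, hm using Nat.le_induction with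
    | base =>
      intro h
      have := hkey a (by simp [h])
      have e : ∑ i ∈ Finset.Ico a (a + 1), z i - c a * z (a + 1) = -(c a * z a) := by
        rw [← this]; simp
      rw [e, norm_neg, norm_mul, hz]
      simp
    | succ m hm ih =>
      intro h
      have hm1 : m ∈ Finset.Ico a b := by simp; omega
      have hm2 : m + 1 ∈ Finset.Ico a b := by simp; omega
      have h0 := ih (by omega)
      have h1 := hkey (m + 1) hm2
      have e : ∑ i ∈ Finset.Ico a (m + 1 + 1), z i - c (m + 1) * z (m + 1 + 1) =
          (∑ i ∈ Finset.Ico a (m + 1), z i - c m * z (m + 1)) + (c m - c (m + 1)) * z (m + 1) := by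
        rw [Finset.sum_Ico_succ_top (by omega)]
        linear_combination -h1
      rw [e]
      refine (norm_add_le _ _).trans ?_
      rw [norm_mul, hz, mul_one, hcsub, abs_of_nonneg]
      · linarith
      · linarith [hwanti m hm1 (m + 1) hm2 (by omega)]
  obtain ⟨m, rfl⟩ : ∃ m, b = m + 1 := ⟨b - 1, by omega⟩
  have ha : a ∈ Finset.Ico a (m + 1) := by simp; omega
  have hm : m ∈ Finset.Ico a (m + 1) := by simp; omega
  have h1 := main m (by omega) (by omega)
  have h2 : ‖c m * z (m + 1)‖ ≤ 1 / (4 * θ) := by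
    rw [norm_mul, hz, mul_one]; exact hcabs m hm
  have h3 := hcabs a ha
  have h4 := (abs_le.1 (hwabs a ha)).2
  have h5 := (abs_le.1 (hwabs m hm)).1
  have h6 := norm_add_le (∑ i ∈ Finset.Ico a (m + 1), z i - c m * z (m + 1)) (c m * z (m + 1))
  rw [sub_add_cancel] at h6
  have e1 : 1 / (2 * θ) = 1 / θ / 2 := by field_simp
  have e2 : 1 / (4 * θ) = 1 / θ / 4 := by field_simp
  rw [e1] at h4 h5
  rw [e2] at h2 h3
  linarith

/-- The exponential `e(t) = exp (2 π i t)`. -/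
noncomputable def expUnit (t : ℝ) : ℂ := Complex.exp (2 * Real.pi * Complex.I * t)

theorem norm_expUnit (t : ℝ) : ‖expUnit t‖ = 1 := by
  have : expUnit t = Complex.exp ((2 * Real.pi * t : ℝ) * Complex.I) := by
    unfold expUnit; congr 1; push_cast; ring
  rw [this, Complex.norm_exp_ofReal_mul_I]

theorem expUnit_add (s t : ℝ) : expUnit (s + t) = expUnit s * expUnit t := by
  unfold expUnit; rw [← Complex.exp_add]; congr 1; push_cast; ring

theorem expUnit_sub_intCast (t : ℝ) (k : ℤ) : expUnit (t - k) = expUnit t := by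
  unfold expUnit
  rw [Complex.exp_eq_exp_iff_exists_int]
  exact ⟨-k, by push_cast; ring⟩

/-- The Kusmin–Landau inequality for sequences with monotone differences. -/
theorem norm_sum_expUnit_le {y d : ℕ → ℝ} (hd : ∀ n, d n = y (n + 1) - y n) (hmono : Monotone d)
    {θ : ℝ} (hθ : 0 < θ) (k : ℤ) {a b : ℕ} (hlow : ∀ n, a ≤ n → n < b → k + θ ≤ d n)
    (hup : ∀ n, a ≤ n → n < b → d n ≤ k + 1 - θ) :
    ‖∑ i ∈ Finset.Ico a b, expUnit (y i)‖ ≤ 1 / θ := by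
  refine norm_sum_Ico_le_of_monotone_phase (t := fun n => d n - k) hθ (fun n => norm_expUnit _)
    (fun n => ?_) (fun i j h => sub_le_sub_right (hmono h) _) ?_ ?_
  · change _ = expUnit (d n - k) * _
    rw [expUnit_sub_intCast, ← expUnit_add, hd]
    congr 1; ring
  · intro n hn
    rw [Finset.mem_Ico] at hn
    linarith [hlow n hn.1 hn.2]
  · intro n hn
    rw [Finset.mem_Ico] at hn
    linarith [hup n hn.1 hn.2]

theorem norm_sum_expUnit_le_card (y : ℕ → ℝ) {a b : ℕ} (hab : a ≤ b) :
    ‖∑ i ∈ Finset.Ico a b, expUnit (y i)‖ ≤ (b : ℝ) - a := by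
  refine (norm_sum_le _ _).trans ?_
  simp [norm_expUnit, Nat.cast_sub hab]

/-! ### Exponential sums whose phase has weakly decreasing second differences. -/

theorem mul_le_sub_of_forall_le_sub {d : ℕ → ℝ} {c : ℝ} {p q : ℕ} (hpq : p ≤ q)
    (h : ∀ i, p ≤ i → i < q → c ≤ d (i + 1) - d i) : c * ((q : ℝ) - p) ≤ d q - d p := by
  induction q, hpq using Nat.le_induction with
  | base => simp
  | succ q hq ih =>
    have h1 := ih fun i hi hi' => h i hi (by omega)
    have h2 := h q hq (by omega)
    push_cast
    linarith

theorem sub_le_mul_of_forall_sub_le {d : ℕ → ℝ} {c : ℝ} {p q : ℕ} (hpq : p ≤ q)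
    (h : ∀ i, p ≤ i → i < q → d (i + 1) - d i ≤ c) : d q - d p ≤ c * ((q : ℝ) - p) := by
  have := mul_le_sub_of_forall_le_sub (d := fun n => -d n) (c := -c) hpq
    fun i hi hi' => by linarith [h i hi hi']
  linarith

/-- The indices below `N` at which a monotone sequence is below a threshold form an initial
segment. -/
theorem Monotone.exists_initial_segment {d : ℕ → ℝ} (hd : Monotone d) (N : ℕ) (t : ℝ) :
    ∃ m ≤ N, ∀ n < N, n < m ↔ d n < t := by
  induction N with
  | zero => exact ⟨0, le_rfl, by simp⟩
  | succ N ih =>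
    by_cases h : d N < t
    · exact ⟨N + 1, le_rfl, fun n hn => iff_of_true hn ((hd (by omega)).trans_lt h)⟩
    · obtain ⟨m, hm, hm'⟩ := ih
      refine ⟨m, by omega, fun n hn => ?_⟩
      rcases Nat.lt_succ_iff_lt_or_eq.1 hn with h' | rfl
      · exact hm' n h'
      · exact iff_of_false (by omega) h

/-- If the increments of `d` are weakly decreasing, the time that `d` spends within `θ` of `κ`
is controlled by the time it spends afterwards before reaching `κ + 1 - θ`. -/
theorem sub_le_of_weaklyDecreasing_increments {d : ℕ → ℝ} {K θ κ : ℝ} (hK : 1 ≤ K)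
    (hpos : ∀ n, d n < d (n + 1))
    (hdec : ∀ n j, n ≤ j → d (j + 1) - d j ≤ K * (d (n + 1) - d n))
    (hθ : 0 < θ) (hθ' : θ ≤ 1 / 4) {p s t : ℕ} (hps : p ≤ s) (hst : s ≤ t)
    (hlow : ∀ n, p ≤ n → n < s → κ - θ ≤ d n) (hup : ∀ n, p ≤ n → n < s → d n < κ + θ)
    (ht : κ + 1 - θ ≤ d t) :
    (s : ℝ) - p ≤ 1 + 4 * θ * K ^ 2 * ((t : ℝ) - s + 1) := by
  have hst' : (s : ℝ) ≤ t := by exact_mod_cast hst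
  rcases hps.eq_or_lt with rfl | hlt
  · have : 0 ≤ 4 * θ * K ^ 2 * ((t : ℝ) - p + 1) := by
      apply mul_nonneg (by positivity); linarith
    linarith
  obtain ⟨r, rfl⟩ : ∃ r, s = r + 1 := ⟨s - 1, by omega⟩
  have hpr : (p : ℝ) ≤ r := by exact_mod_cast (by omega : p ≤ r)
  -- Earlier increments are at least `v / K` and later ones at most `K * v`. The climb before `r` is
  -- below `2 * θ`; the climb from `r` to `t` exceeds `1 - 2 * θ ≥ 1 / 2`.
  set v := d (r + 1) - d r with hv
  have hv0 : 0 < v := sub_pos.2 (hpos r)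
  have h1 := mul_le_sub_of_forall_le_sub (d := d) (c := v / K) (by omega : p ≤ r)
    fun i hi hi' => by
      rw [div_le_iff₀ (by linarith)]
      linarith [hdec i r hi'.le]
  have h2 := sub_le_mul_of_forall_sub_le (d := d) (c := K * v) (by omega : r ≤ t)
    fun i hi hi' => hdec r i hi
  have h3 := hlow p le_rfl hlt
  have h4 := hup r (by omega) (by omega)
  push_cast at hst' ⊢
  rw [div_mul_eq_mul_div, div_le_iff₀ (by linarith)] at h1
  have h5 : v * ((r : ℝ) - p) ≤ 2 * θ * K := by nlinarith
  have h6 : 1 ≤ 2 * (K * v * ((t : ℝ) - r)) := by linarith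
  have h7 : (r : ℝ) - p ≤ ((r : ℝ) - p) * (2 * (K * v * ((t : ℝ) - r))) :=
    le_mul_of_one_le_right (by linarith) h6
  have h8 : 2 * K * ((t : ℝ) - r) * (v * ((r : ℝ) - p)) ≤ 2 * K * ((t : ℝ) - r) * (2 * θ * K) :=
    mul_le_mul_of_nonneg_left h5 (mul_nonneg (by linarith) (by linarith))
  nlinarith

/-- A nonasymptotic bound for exponential sums with weakly decreasing positive second differences. -/
theorem norm_sum_expUnit_range_le {y d : ℕ → ℝ} {K θ η : ℝ} (hd : ∀ n, d n = y (n + 1) - y n)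
    (hK : 1 ≤ K) (hpos : ∀ n, d n < d (n + 1))
    (hdec : ∀ n j, n ≤ j → d (j + 1) - d j ≤ K * (d (n + 1) - d n))
    (hθ : 0 < θ) (hθ' : θ ≤ 1 / 4) (hη : 0 < η) (hηθ : η ≤ θ) (M : ℕ) :
    ‖∑ i ∈ Finset.range (M + 1), expUnit (y i)‖ ≤
      (d M - d 0 + 1) * (1 / θ + 1 + 4 * θ * K ^ 2) + 4 * θ * K ^ 2 * (M + 1) +
        (2 / η + 1 + 2 * η * K / (d (M + 1) - d M)) := by
  have hmono : Monotone d := monotone_nat_of_le_succ fun n => (hpos n).le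
  choose A hAN hA using hmono.exists_initial_segment (M + 1)
  have hAmono : Monotone A := by
    intro s t hst
    by_contra! h
    have h1 := (hA s (A t) (h.trans_le (hAN s))).1 h
    have h2 := (hA t (A t) (h.trans_le (hAN s))).2 (h1.trans_le hst)
    exact lt_irrefl _ h2
  have hge : ∀ t n, A t ≤ n → n < M + 1 → t ≤ d n := by
    intro t n h1 h2
    by_contra! h
    have := (hA t n h2).2 h
    omega
  have hlt : ∀ t n, n < A t → d n < t := fun t n h =>
    (hA t n (h.trans_le (hAN t))).1 h
  set F : ℕ → ℂ := fun n => ∑ i ∈ Finset.range n, expUnit (y i) with hF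
  have hFsub : ∀ a b, a ≤ b → F b = F a + ∑ i ∈ Finset.Ico a b, expUnit (y i) := fun a b hab =>
    (Finset.sum_range_add_sum_Ico _ hab).symm
  set k₀ : ℤ := ⌊d 0 + θ⌋ with hk₀
  set k₁ : ℤ := ⌊d M + θ⌋ with hk₁
  have hk₀le := Int.floor_le (d 0 + θ)
  have hk₀lt := Int.lt_floor_add_one (d 0 + θ)
  have hk₁le := Int.floor_le (d M + θ)
  have hk₁lt := Int.lt_floor_add_one (d M + θ)
  rw [← hk₀] at hk₀le hk₀lt
  rw [← hk₁] at hk₁le hk₁lt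
  have hk : k₀ ≤ k₁ := Int.floor_le_floor (by linarith [hmono (Nat.zero_le M)])
  -- Each block, from `k - θ` to `k + 1 - θ`, pays a fixed cost plus a multiple of its length, and
  -- the lengths add up to the final index.
  have complete : ∀ j : ℕ, k₀ + j ≤ k₁ →
      ‖F (A ((k₀ + j : ℤ) - θ))‖ ≤ j * (1 / θ + 1 + 4 * θ * K ^ 2) +
        4 * θ * K ^ 2 * A ((k₀ + j : ℤ) - θ) := by
    intro j
    induction j with
    | zero =>
      intro _
      have : A ((k₀ + (0 : ℕ) : ℤ) - θ) = 0 := by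
        by_contra h
        have := hlt _ 0 (Nat.pos_of_ne_zero h)
        push_cast at this
        linarith
      rw [this]
      simp [hF]
    | succ j ih =>
      intro hj
      have ih := ih (by push_cast at hj; omega)
      set k : ℤ := k₀ + j with hkdef
      have hk1 : (((k₀ + (j + 1 : ℕ) : ℤ)) : ℝ) - θ = k + 1 - θ := by
        rw [hkdef]; push_cast; ring
      rw [hk1]
      have hkk : (k : ℝ) + 1 ≤ k₁ := by
        have : k + 1 ≤ k₁ := by push_cast at hj; omega
        exact_mod_cast this
      set p := A (k - θ)
      set s := A (k + θ)
      set t := A (k + 1 - θ) with ht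
      have hps : p ≤ s := hAmono (by linarith)
      have hst : s ≤ t := hAmono (by linarith)
      have htM : t < M + 1 := by
        by_contra! h
        have := hlt (k + 1 - θ) M (by rw [ht] at h; omega)
        linarith
      have hbad := sub_le_of_weaklyDecreasing_increments (κ := k) hK hpos hdec hθ hθ' hps hst
        (fun n h1 h2 => hge _ n h1 (by omega)) (fun n h1 h2 => hlt _ n h2) (hge _ t le_rfl htM)
      have hgood := norm_sum_expUnit_le hd hmono hθ k (a := s) (b := t)
        (fun n h1 h2 => hge _ n h1 (by omega)) (fun n h1 h2 => (hlt _ n h2).le)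
      have hcard := norm_sum_expUnit_le_card y hps
      have e : F t = F p + ∑ i ∈ Finset.Ico p s, expUnit (y i) +
          ∑ i ∈ Finset.Ico s t, expUnit (y i) := by
        rw [hFsub s t hst, hFsub p s hps]
      have h1 := norm_add₃_le (a := F p) (b := ∑ i ∈ Finset.Ico p s, expUnit (y i))
        (c := ∑ i ∈ Finset.Ico s t, expUnit (y i))
      rw [e]
      have hps' : (p : ℝ) ≤ s := by exact_mod_cast hps
      have h2 : 4 * θ * K ^ 2 * p ≤ 4 * θ * K ^ 2 * s :=
        mul_le_mul_of_nonneg_left hps' (by positivity)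
      push_cast
      nlinarith
  have hJ := complete (k₁ - k₀).toNat (by omega)
  have hJk : k₀ + ((k₁ - k₀).toNat : ℤ) = k₁ := by omega
  have hJr : (((k₁ - k₀).toNat : ℕ) : ℝ) = k₁ - k₀ := by
    have : ((((k₁ - k₀).toNat : ℕ) : ℤ) : ℝ) = ((k₁ - k₀ : ℤ) : ℝ) := by congr 1; omega
    push_cast at this
    exact this
  rw [hJk, hJr] at hJ
  set q := A (k₁ - θ)
  set p := A (k₁ - η)
  set s := A (k₁ + η)
  have hqp : q ≤ p := hAmono (by linarith)
  have hps : p ≤ s := hAmono (by linarith)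
  have hsM : s ≤ M + 1 := hAN _
  have h1 := norm_sum_expUnit_le hd hmono hη (k₁ - 1) (a := q) (b := p)
    (fun n h1 h2 => by
      have := hge _ n h1 (by omega)
      push_cast
      linarith)
    (fun n h1 h2 => by
      have := hlt _ n h2
      push_cast
      linarith)
  have h3 := norm_sum_expUnit_le hd hmono hη k₁ (a := s) (b := M + 1)
    (fun n h1 h2 => hge _ n h1 (by omega))
    (fun n h1 h2 => by
      have := hmono (by omega : n ≤ M)
      linarith)
  have hv : 0 < d (M + 1) - d M := sub_pos.2 (hpos M)
  -- `d` crosses a window of width `2 * η` with steps at least `1 / K` times the increment at `M`.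
  have h2 : (s : ℝ) - p ≤ 1 + 2 * η * K / (d (M + 1) - d M) := by
    rcases hps.eq_or_lt with h | h
    · rw [h, sub_self]; positivity
    obtain ⟨r, hr⟩ : ∃ r, s = r + 1 := ⟨s - 1, by omega⟩
    have := mul_le_sub_of_forall_le_sub (d := d) (c := (d (M + 1) - d M) / K) (by omega : p ≤ r)
      fun i hi hi' => by
        rw [div_le_iff₀ (by linarith)]
        linarith [hdec i M (by omega)]
    rw [div_mul_eq_mul_div, div_le_iff₀ (by linarith)] at this
    have h4 := hlt _ r (by omega : r < s)
    have h5 := hge (k₁ - η) p le_rfl (by omega)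
    rw [hr, ← sub_le_iff_le_add', le_div_iff₀ hv]
    push_cast
    nlinarith
  have h2' := norm_sum_expUnit_le_card y hps
  have e : F (M + 1) = F q + ∑ i ∈ Finset.Ico q p, expUnit (y i) +
      ∑ i ∈ Finset.Ico p s, expUnit (y i) + ∑ i ∈ Finset.Ico s (M + 1), expUnit (y i) := by
    rw [hFsub s _ hsM, hFsub p s hps, hFsub q p hqp]
  change ‖F (M + 1)‖ ≤ _
  rw [e]
  have h4 := norm_add₄_le (a := F q) (b := ∑ i ∈ Finset.Ico q p, expUnit (y i))
    (c := ∑ i ∈ Finset.Ico p s, expUnit (y i)) (d := ∑ i ∈ Finset.Ico s (M + 1), expUnit (y i))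
  have h5 : 4 * θ * K ^ 2 * q ≤ 4 * θ * K ^ 2 * (M + 1) := by
    apply mul_le_mul_of_nonneg_left _ (by positivity)
    exact_mod_cast hAN _
  have h6 : ((k₁ : ℝ) - k₀) * (1 / θ + 1 + 4 * θ * K ^ 2) ≤
      (d M - d 0 + 1) * (1 / θ + 1 + 4 * θ * K ^ 2) :=
    mul_le_mul_of_nonneg_right (by linarith) (by positivity)
  have e2 : 2 / η = 1 / η + 1 / η := by ring
  rw [e2]
  linarith

/-- Exponential sums with weakly decreasing positive second differences `d (n + 1) - d n` that tend
to zero more slowly than `1 / n ^ 2` are `o(N)`. -/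
theorem tendsto_average_expUnit {y d : ℕ → ℝ} {K : ℝ} (hd : ∀ n, d n = y (n + 1) - y n)
    (hK : 1 ≤ K) (hpos : ∀ n, d n < d (n + 1))
    (hdec : ∀ n j, n ≤ j → d (j + 1) - d j ≤ K * (d (n + 1) - d n))
    (hzero : Tendsto (fun n => d (n + 1) - d n) atTop (𝓝 0))
    (hinf : Tendsto (fun n : ℕ => ((n : ℝ) + 1) ^ 2 * (d (n + 1) - d n)) atTop atTop) :
    Tendsto (fun M : ℕ => (∑ i ∈ Finset.range (M + 1), expUnit (y i)) / ((M : ℂ) + 1)) atTop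
      (𝓝 0) := by
  set u : ℕ → ℝ := fun n => d (n + 1) - d n with hu
  have hu0 : ∀ n, 0 < u n := fun n => sub_pos.2 (hpos n)
  have hsqrt : Tendsto (fun n => √(u n)) atTop (𝓝 0) := by
    exact (Real.continuous_sqrt.tendsto' 0 0 Real.sqrt_zero).comp hzero
  have hones : Tendsto (fun n : ℕ => 1 / ((n : ℝ) + 1)) atTop (𝓝 0) :=
    tendsto_one_div_add_atTop_nhds_zero_nat
  have hlast : Tendsto (fun n : ℕ => 1 / (√(u n) * ((n : ℝ) + 1))) atTop (𝓝 0) := by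
    have h := Real.tendsto_sqrt_atTop.comp hinf
    refine (tendsto_inv_atTop_zero.comp h).congr fun n => ?_
    have : (0 : ℝ) ≤ n + 1 := by positivity
    simp only [Function.comp_apply]
    rw [Real.sqrt_mul (by positivity), Real.sqrt_sq this, one_div, mul_comm]
  have hces : Tendsto (fun n : ℕ => (d n - d 0 + 1) / ((n : ℝ) + 1)) atTop (𝓝 0) := by
    have h := (tendsto_add_atTop_iff_nat 1).2 hzero.cesaro
    have h2 := (h.sub (hones.mul hzero)).add hones
    simp only [mul_zero, sub_zero, add_zero] at h2
    refine h2.congr fun n => ?_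
    rw [Finset.sum_range_sub]
    push_cast
    field_simp
    ring
  rw [tendsto_zero_iff_norm_tendsto_zero]
  rw [Metric.tendsto_atTop']
  intro ε hε
  -- `4 * θ * K ^ 2` is the only term that survives in the limit; this choice keeps it below `ε`.
  set θ : ℝ := min (1 / 4) (ε / (16 * K ^ 2)) with hθdef
  have hθ : 0 < θ := by positivity
  have hθε : 4 * θ * K ^ 2 ≤ ε / 4 := by
    have h : θ ≤ ε / (16 * K ^ 2) := min_le_right _ _
    rw [le_div_iff₀ (by positivity)] at h
    linarith
  have hlim : Tendsto (fun n : ℕ => (d n - d 0 + 1) / ((n : ℝ) + 1) *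
      (1 / θ + 1 + 4 * θ * K ^ 2) + 4 * θ * K ^ 2 + ((2 + 2 * K) *
        (1 / (√(u n) * ((n : ℝ) + 1))) + 1 / ((n : ℝ) + 1))) atTop
      (𝓝 (0 * (1 / θ + 1 + 4 * θ * K ^ 2) + 4 * θ * K ^ 2 + ((2 + 2 * K) * 0 + 0))) :=
    ((hces.mul_const _).add_const _).add ((hlast.const_mul _).add hones)
  have hev := (hlim.eventually_lt_const (u := ε) (by linarith)).and
    (hsqrt.eventually_le_const hθ)
  obtain ⟨N, hN⟩ := eventually_atTop.1 hev
  refine ⟨N, fun n hn => ?_⟩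
  obtain ⟨h1, h2⟩ := hN n hn.le
  have hs : 0 < √(u n) := Real.sqrt_pos.2 (hu0 n)
  have hb := norm_sum_expUnit_range_le hd hK hpos hdec hθ (min_le_left _ _) hs h2 n
  rw [dist_zero_right, norm_norm, norm_div]
  have hn1 : ‖(n : ℂ) + 1‖ = (n : ℝ) + 1 := by
    exact_mod_cast Complex.norm_natCast (n + 1)
  rw [hn1]
  refine lt_of_le_of_lt ?_ h1
  rw [div_le_iff₀ (by positivity)]
  refine hb.trans (le_of_eq ?_)
  have e : 2 * √(u n) * K / (d (n + 1) - d n) = 2 * K / √(u n) := by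
    change 2 * √(u n) * K / u n = _
    rw [div_eq_div_iff (hu0 n).ne' hs.ne']
    linear_combination (2 * K) * Real.mul_self_sqrt (hu0 n).le
  rw [e]
  field_simp
  ring

/-! ### Weyl's criterion through weak convergence on the circle. -/

open MeasureTheory in
/-- Convergence of all Fourier coefficients implies weak convergence on the circle. -/
theorem tendsto_probabilityMeasure_of_tendsto_integral_fourier {ι : Type*} {l : Filter ι}
    {μs : ι → ProbabilityMeasure UnitAddCircle} {μ : ProbabilityMeasure UnitAddCircle}
    (h : ∀ n : ℤ, Tendsto (fun i => ∫ t, fourier n t ∂(μs i : Measure UnitAddCircle)) l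
      (𝓝 (∫ t, fourier n t ∂(μ : Measure UnitAddCircle)))) :
    Tendsto μs l (𝓝 μ) := by
  have hint : ∀ (ν : ProbabilityMeasure UnitAddCircle) (f : C(UnitAddCircle, ℂ)),
      Integrable f (ν : Measure UnitAddCircle) := fun ν f =>
    f.continuous.integrable_of_hasCompactSupport (HasCompactSupport.of_compactSpace _)
  -- A uniform Lipschitz constant makes the set of `f` with convergent integrals closed, so the
  -- dense span of the characters suffices.
  have hlip : ∀ ν : ProbabilityMeasure UnitAddCircle, LipschitzWith 1
      (fun f : C(UnitAddCircle, ℂ) => ∫ t, f t ∂(ν : Measure UnitAddCircle)) := by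
    intro ν
    refine LipschitzWith.of_dist_le_mul fun f g => ?_
    rw [dist_eq_norm, ← integral_sub (hint ν f) (hint ν g), NNReal.coe_one, one_mul]
    refine (norm_integral_le_of_norm_le_const (C := dist f g)
      (Eventually.of_forall fun t => ?_)).trans ?_
    · rw [← dist_eq_norm]; exact ContinuousMap.dist_apply_le_dist t
    · simp
  have hequi : Equicontinuous fun (i : ι) (f : C(UnitAddCircle, ℂ)) =>
      ∫ t, f t ∂(μs i : Measure UnitAddCircle) :=
    (LipschitzWith.uniformEquicontinuous _ 1 fun i => hlip (μs i)).equicontinuous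
  have hclosed := hequi.isClosed_setOfPred_tendsto (l := l) (hlip μ).continuous
  have hspan : (Submodule.span ℂ (Set.range (fourier (T := 1))) : Set C(UnitAddCircle, ℂ)) ⊆
      {f | Tendsto (fun i => ∫ t, f t ∂(μs i : Measure UnitAddCircle)) l
        (𝓝 (∫ t, f t ∂(μ : Measure UnitAddCircle)))} := by
    intro f hf
    refine Submodule.span_induction ?_ ?_ ?_ ?_ hf
    · rintro _ ⟨n, rfl⟩
      exact h n
    · simp [tendsto_const_nhds]
    · intro f g _ _ hf hg
      have := Tendsto.add hf hg
      simpa only [Set.mem_ofPred_eq, ContinuousMap.add_apply, integral_add (hint _ f) (hint _ g)]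
        using this
    · intro c f _ hf
      have := Tendsto.const_mul c hf
      simpa only [Set.mem_ofPred_eq, ContinuousMap.smul_apply, smul_eq_mul, integral_const_mul]
        using this
  rw [ProbabilityMeasure.tendsto_iff_forall_integral_rclike_tendsto ℂ]
  intro f
  have hmem : f.toContinuousMap ∈
      (Submodule.span ℂ (Set.range (fourier (T := (1 : ℝ))))).topologicalClosure := by
    rw [span_fourier_closure_eq_top]; trivial
  exact closure_minimal hspan hclosed hmem

/-- Translation by `1 / (2 * n)` preserves the measure and flips the sign of the character. -/
theorem integral_fourier_eq_zero {n : ℤ} (hn : n ≠ 0) :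
    ∫ t : UnitAddCircle, fourier n t = 0 :=
  MeasureTheory.integral_eq_zero_of_add_right_eq_neg
    (g := ((1 / 2 / n : ℝ) : UnitAddCircle)) (fun t => by
      simpa using fourier_add_half_inv_index hn (zero_lt_one' ℝ) t)

theorem UnitAddCircle.coe_mem_image_Ico_iff {a b : ℝ} (ha : 0 ≤ a) (hb : b ≤ 1) (t : ℝ) :
    (t : UnitAddCircle) ∈ ((↑) : ℝ → UnitAddCircle) '' Set.Ico a b ↔
      Int.fract t ∈ Set.Ico a b := by
  have hfr : ((Int.fract t : ℝ) : UnitAddCircle) = t := by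
    rw [← sub_eq_zero, ← AddCircle.coe_sub, AddCircle.coe_eq_zero_iff]
    exact ⟨-⌊t⌋, by rw [← Int.self_sub_floor]; simp⟩
  constructor
  · rintro ⟨s, hs, hst⟩
    have : s = Int.fract t := by
      rw [← hfr] at hst
      refine (AddCircle.coe_eq_coe_iff_of_mem_Ico (p := (1 : ℝ)) (a := 0) ?_ ?_).1 hst
      · rw [zero_add]; exact ⟨ha.trans hs.1, hs.2.trans_le hb⟩
      · rw [zero_add]; exact ⟨Int.fract_nonneg t, Int.fract_lt_one t⟩
    rwa [← this]
  · intro h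
    exact ⟨_, h, hfr⟩

theorem UnitAddCircle.measurableSet_image_Ico {a b : ℝ} (hab : a < b) :
    MeasurableSet (((↑) : ℝ → UnitAddCircle) '' Set.Ico a b) := by
  rw [← Set.Ioo_insert_left hab, Set.image_insert_eq]
  exact (QuotientAddGroup.isOpenMap_coe _ isOpen_Ioo).measurableSet.insert _

open MeasureTheory in
theorem UnitAddCircle.volume_image_Ico {a b : ℝ} (ha : 0 ≤ a) (hab : a < b) (hb : b ≤ 1) :
    volume (((↑) : ℝ → UnitAddCircle) '' Set.Ico a b) = ENNReal.ofReal (b - a) := by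
  rw [AddCircle.add_projection_respects_measure 1 0 (measurableSet_image_Ico hab), zero_add]
  have hae : (QuotientAddGroup.mk ⁻¹' (((↑) : ℝ → UnitAddCircle) '' Set.Ico a b) ∩
      Set.Ioc 0 1 : Set ℝ) =ᵐ[volume] (QuotientAddGroup.mk ⁻¹'
        (((↑) : ℝ → UnitAddCircle) '' Set.Ico a b) ∩ Set.Ico 0 1 : Set ℝ) :=
    (ae_eq_refl _).inter Ico_ae_eq_Ioc.symm
  have heq : (QuotientAddGroup.mk ⁻¹' (((↑) : ℝ → UnitAddCircle) '' Set.Ico a b) ∩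
      Set.Ico 0 1 : Set ℝ) = Set.Ico a b := by
    ext t
    constructor
    · rintro ⟨h1, h2⟩
      have := (UnitAddCircle.coe_mem_image_Ico_iff ha hb t).1 h1
      rwa [Int.fract_eq_self.2 h2] at this
    · intro h
      exact ⟨⟨t, h, rfl⟩, ha.trans h.1, h.2.trans_le hb⟩
  rw [measure_congr hae, heq, Real.volume_Ico]

-- Needed for the portmanteau theorem: the frontier lies in the images of the two endpoints.
open MeasureTheory in
theorem UnitAddCircle.volume_frontier_image_Ico (a b : ℝ) :
    volume (frontier (((↑) : ℝ → UnitAddCircle) '' Set.Ico a b)) = 0 := by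
  have hsing : ∀ x : UnitAddCircle, volume {x} = 0 := fun x => by
    rw [← Metric.closedBall_zero, AddCircle.volume_closedBall]
    simp
  refine measure_mono_null (t := {(a : UnitAddCircle)} ∪ {(b : UnitAddCircle)}) ?_
    (measure_union_null (hsing _) (hsing _))
  have hclosed : closure (((↑) : ℝ → UnitAddCircle) '' Set.Ico a b) ⊆
      ((↑) : ℝ → UnitAddCircle) '' Set.Icc a b :=
    closure_minimal (Set.image_mono Set.Ico_subset_Icc_self)
      (isCompact_Icc.image (AddCircle.continuous_mk' 1)).isClosed
  have hopen : ((↑) : ℝ → UnitAddCircle) '' Set.Ioo a b ⊆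
      interior (((↑) : ℝ → UnitAddCircle) '' Set.Ico a b) :=
    interior_maximal (Set.image_mono Set.Ioo_subset_Ico_self)
      (QuotientAddGroup.isOpenMap_coe _ isOpen_Ioo)
  rintro x ⟨hx, hx'⟩
  obtain ⟨t, ht, rfl⟩ := hclosed hx
  by_contra hne
  simp only [Set.mem_union, Set.mem_singleton_iff, not_or] at hne
  refine hx' (hopen ⟨t, ⟨lt_of_le_of_ne ht.1 ?_, lt_of_le_of_ne ht.2 ?_⟩, rfl⟩)
  · rintro rfl; exact hne.1 rfl
  · rintro rfl; exact hne.2 rfl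

open MeasureTheory in
/-- The uniform probability measure on the first `N + 1` terms of a sequence. -/
noncomputable def empiricalMeasure {X : Type*} [MeasurableSpace X] (y : ℕ → X) (N : ℕ) :
    ProbabilityMeasure X :=
  ⟨((N : ENNReal) + 1)⁻¹ • ∑ i ∈ Finset.range (N + 1), Measure.dirac (y i), ⟨by
    simp only [Measure.smul_apply, Measure.finsetSum_apply, measure_univ, Finset.sum_const,
      Finset.card_range, smul_eq_mul, nsmul_eq_mul, mul_one]
    push_cast
    exact ENNReal.inv_mul_cancel (by simp) (by finiteness)⟩⟩

open MeasureTheory in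
theorem integral_empiricalMeasure {X : Type*} [MeasurableSpace X] (y : ℕ → X) (N : ℕ) {f : X → ℂ}
    (hf : StronglyMeasurable f) :
    ∫ t, f t ∂(empiricalMeasure y N : Measure X) =
      (∑ i ∈ Finset.range (N + 1), f (y i)) / ((N : ℂ) + 1) := by
  change ∫ t, f t ∂(((N : ENNReal) + 1)⁻¹ • ∑ i ∈ Finset.range (N + 1), Measure.dirac (y i)) = _
  rw [integral_smul_measure, integral_finsetSum_measure]
  · simp_rw [integral_dirac' _ _ hf]
    rw [ENNReal.toReal_inv, ENNReal.toReal_add (by simp) (by simp)]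
    simp only [ENNReal.toReal_natCast, ENNReal.toReal_one, Complex.real_smul]
    push_cast
    rw [div_eq_inv_mul]
  · intro i _
    exact integrable_dirac' hf (by simp)

open MeasureTheory in
open scoped Classical in
theorem empiricalMeasure_apply {X : Type*} [MeasurableSpace X] (y : ℕ → X) (N : ℕ) {s : Set X}
    (hs : MeasurableSet s) :
    (empiricalMeasure y N : Measure X) s =
      ((N : ENNReal) + 1)⁻¹ * ((Finset.range (N + 1)).filter (fun i => y i ∈ s)).card := by
  change (((N : ENNReal) + 1)⁻¹ • ∑ i ∈ Finset.range (N + 1), Measure.dirac (y i)) s = _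
  simp [Measure.dirac_apply' _ hs, Set.indicator_apply]

open MeasureTheory in
/-- **Weyl's criterion**. -/
theorem uniformlyDistributedModOne_of_tendsto_average {x : ℕ → ℝ}
    (h : ∀ k : ℤ, k ≠ 0 → Tendsto (fun N : ℕ =>
      (∑ i ∈ Finset.range (N + 1), expUnit (k * x (i + 1))) / ((N : ℂ) + 1)) atTop (𝓝 0)) :
    UniformlyDistributedModOne x := by
  classical
  intro a b ha hab hb
  set y : ℕ → UnitAddCircle := fun i => (x (i + 1) : UnitAddCircle)
  have hprob : IsProbabilityMeasure (volume : Measure UnitAddCircle) := ⟨by simp⟩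
  let μ : ProbabilityMeasure UnitAddCircle := ⟨volume, hprob⟩
  have hlim : Tendsto (empiricalMeasure y) atTop (𝓝 μ) := by
    refine tendsto_probabilityMeasure_of_tendsto_integral_fourier fun n => ?_
    simp_rw [integral_empiricalMeasure y _ (fourier n).continuous.stronglyMeasurable]
    change Tendsto _ _ (𝓝 (∫ t : UnitAddCircle, fourier n t))
    rcases eq_or_ne n 0 with rfl | hn
    · refine Tendsto.congr (f₁ := fun _ => (1 : ℂ)) (fun N => ?_) ?_
      · have : (N : ℂ) + 1 ≠ 0 := by exact_mod_cast N.succ_ne_zero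
        simp [this]
      · simp
    · rw [integral_fourier_eq_zero hn]
      refine (h n hn).congr fun N => ?_
      congr 1
      refine Finset.sum_congr rfl fun i _ => ?_
      rw [fourier_coe_apply]
      unfold expUnit
      congr 1
      push_cast
      ring
  set E : Set UnitAddCircle := ((↑) : ℝ → UnitAddCircle) '' Set.Ico a b with hE
  have hE' : MeasurableSet E := UnitAddCircle.measurableSet_image_Ico hab
  have hconv := ProbabilityMeasure.tendsto_measure_of_null_frontier_of_tendsto' hlim
    (E := E) (UnitAddCircle.volume_frontier_image_Ico a b)
  change Tendsto _ _ (𝓝 (volume E)) at hconv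
  rw [UnitAddCircle.volume_image_Ico ha hab hb] at hconv
  have hconv := (ENNReal.tendsto_toReal ENNReal.ofReal_ne_top).comp hconv
  rw [ENNReal.toReal_ofReal (by linarith)] at hconv
  -- `empiricalMeasure y N` carries `N + 1` points, namely `x 1` to `x (N + 1)`.
  rw [← tendsto_add_atTop_iff_nat 1]
  refine hconv.congr fun N => ?_
  have hcount : countFract x a b (N + 1) =
      ((Finset.range (N + 1)).filter (fun i => y i ∈ E)).card := by
    unfold countFract
    rw [← Finset.card_map (addRightEmbedding 1), ← Set.ncard_coe_finset]
    congr 1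
    ext n
    simp only [Finset.coe_map, Finset.coe_filter, Finset.mem_range, addRightEmbedding_apply,
      Set.mem_image, Set.mem_ofPred_eq]
    constructor
    · rintro ⟨h1, h2, h3⟩
      refine ⟨n - 1, ⟨by omega, (UnitAddCircle.coe_mem_image_Ico_iff ha hb _).2 ?_⟩, by omega⟩
      rwa [Nat.sub_add_cancel h1]
    · rintro ⟨m, ⟨h1, h2⟩, rfl⟩
      exact ⟨by omega, by omega, (UnitAddCircle.coe_mem_image_Ico_iff ha hb _).1 h2⟩
  simp only [Function.comp_apply]
  rw [empiricalMeasure_apply y N hE', ENNReal.toReal_mul, ENNReal.toReal_inv,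
    ENNReal.toReal_add (by simp) (by simp), hcount]
  simp only [ENNReal.toReal_natCast, ENNReal.toReal_one]
  push_cast
  rw [div_eq_inv_mul]

/-! ### Reduction of the theorem to positive second differences. -/

theorem tendsto_average_expUnit_of_weaklyDecreasing {x : ℕ → ℝ}
    (hmono : WeaklyDecreasing (secondDiff x))
    (hzero : Tendsto (secondDiff x) atTop (𝓝 0))
    (hinf : Tendsto (fun n : ℕ => |(n : ℝ) ^ 2 * secondDiff x n|) atTop atTop) {k : ℕ}
    (hk : 0 < k) :
    Tendsto (fun N : ℕ => (∑ i ∈ Finset.range (N + 1), expUnit (k * x (i + 1))) / ((N : ℂ) + 1))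
      atTop (𝓝 0) := by
  obtain ⟨hnonneg, K, hK, hdec⟩ := hmono
  -- A single zero would force all later second differences to vanish, against `hinf`.
  have hpos : ∀ n, 1 ≤ n → 0 < secondDiff x n := by
    intro n hn
    refine (hnonneg n hn).lt_of_ne fun h0 => ?_
    obtain ⟨m, hm1, hm2⟩ := ((hinf.eventually_gt_atTop 0).and (eventually_gt_atTop n)).exists
    have h1 := hdec n m hn hm2
    have h2 := hnonneg m (by omega)
    rw [← h0, mul_zero] at h1
    rw [le_antisymm h1 h2] at hm1
    simp at hm1
  have hk' : (0 : ℝ) < k := by exact_mod_cast hk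
  set y : ℕ → ℝ := fun i => k * x (i + 1) with hy
  set d : ℕ → ℝ := fun i => y (i + 1) - y i with hd
  have hdd : ∀ n, d (n + 1) - d n = k * secondDiff x (n + 1) := fun n => by
    simp only [hd, hy, secondDiff, fwdDiff]; ring
  refine tendsto_average_expUnit (y := y) (d := d) (fun _ => rfl) hK (fun n => ?_)
    (fun n j hnj => ?_) ?_ ?_
  · rw [← sub_pos, hdd]
    exact mul_pos hk' (hpos _ (by omega))
  · rw [hdd, hdd]
    have h1 : secondDiff x (j + 1) ≤ K * secondDiff x (n + 1) := by
      rcases hnj.eq_or_lt with rfl | h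
      · exact le_mul_of_one_le_left (hnonneg _ (by omega)) hK
      · exact hdec _ _ (by omega) (by omega)
    nlinarith
  · simp_rw [hdd]
    simpa using ((tendsto_add_atTop_iff_nat 1).2 hzero).const_mul (k : ℝ)
  · simp_rw [hdd]
    refine (((tendsto_add_atTop_iff_nat 1).2 hinf).const_mul_atTop hk').congr fun n => ?_
    rw [abs_of_nonneg (mul_nonneg (by positivity) (hnonneg _ (by omega)))]
    push_cast
    ring

theorem expUnit_neg (t : ℝ) : expUnit (-t) = (starRingEnd ℂ) (expUnit t) := by
  unfold expUnit
  rw [← Complex.exp_conj]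
  congr 1
  simp [Complex.conj_ofNat]

theorem tendsto_average_expUnit_neg {y : ℕ → ℝ}
    (h : Tendsto (fun N : ℕ => (∑ i ∈ Finset.range (N + 1), expUnit (y i)) / ((N : ℂ) + 1))
      atTop (𝓝 0)) :
    Tendsto (fun N : ℕ => (∑ i ∈ Finset.range (N + 1), expUnit (-y i)) / ((N : ℂ) + 1))
      atTop (𝓝 0) := by
  have h2 := (Complex.continuous_conj.tendsto 0).comp h
  rw [map_zero] at h2
  refine h2.congr fun N => ?_
  simp [expUnit_neg]

theorem theorem1 (x : ℕ → ℝ)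
    (hmono : WeaklyMonotonic (secondDiff x))
    (hzero : Tendsto (secondDiff x) atTop (𝓝 0))
    (hinf : Tendsto (fun n : ℕ => |(n : ℝ) ^ 2 * secondDiff x n|) atTop atTop) :
    UniformlyDistributedModOne x := by
  have hnat : ∀ k : ℕ, 0 < k → Tendsto (fun N : ℕ =>
      (∑ i ∈ Finset.range (N + 1), expUnit (k * x (i + 1))) / ((N : ℂ) + 1)) atTop (𝓝 0) := by
    intro k hk
    rcases hmono with hmono | hmono
    · exact tendsto_average_expUnit_of_weaklyDecreasing hmono hzero hinf hk
    · have hneg : secondDiff (fun n => -x n) = fun n => -secondDiff x n := by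
        funext n; simp only [secondDiff, fwdDiff]; ring
      have h := tendsto_average_expUnit_of_weaklyDecreasing (x := fun n => -x n)
        (by rw [hneg]; exact hmono) (by rw [hneg]; simpa using hzero.neg)
        (by rw [hneg]; simpa using hinf) hk
      simpa using tendsto_average_expUnit_neg h
  refine uniformlyDistributedModOne_of_tendsto_average fun k hk => ?_
  rcases lt_or_gt_of_ne hk with hneg | hpos
  · have h := tendsto_average_expUnit_neg (hnat k.natAbs (Int.natAbs_pos.2 hk))
    have e : ((k.natAbs : ℕ) : ℝ) = -(k : ℝ) := by
      rw [Nat.cast_natAbs, abs_of_neg hneg]; push_cast; rfl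
    simpa [e] using h
  · have h := hnat k.natAbs (Int.natAbs_pos.2 hk)
    have e : ((k.natAbs : ℕ) : ℝ) = (k : ℝ) := by
      rw [Nat.cast_natAbs, abs_of_pos hpos]
    simpa only [e] using h
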